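/- A growth function is a continuous nondecreasing map $\Phi$ of $[0,\infty)$ onto itself. For $p\ge 1$, let $\mathscr U^p$ be the set of convex growth functions $\Phi$, of class $C^1$ on $(0,\infty)$, such that $\Phi(t)/t$ is nondecreasing on $(0,\infty)$ and, for some $C>0$, $\Phi(st)\le C t^p\Phi(s)$ for all $t\ge 1$, $s>0$. For $0<p\le 1$, let $\mathscr L_p$ be the set of concave growth functions $\Phi$, of class $C^1$ on $(0,\infty)$, such that $\Phi(t)/t$ is nonincreasing on $(0,\infty)$ and, for some $C>0$, $\Phi(st)\le C t^p\Phi(s)$ for all $0<t\le 1$, $s>0$. Put $\mathscr U=\bigcup_{p\ge1}\mathscr U^p$ and $\mathscr L=\bigcup_{0<p\le1}\mathscr L_p$; the members of $\mathscr L\cup\mathscr U$ are homeomorphisms of $[0,\infty)$. Let $\widetilde{\mathscr U}$ (resp. $\widetilde{\mathscr L}$) be the set of all $\Phi$ that, for some $q\ge1$ (resp. some $0<p\le 1$), belong to $\mathscr U^q$ (resp. $\mathscr L_p$) and satisfy, for some constants $C_1,C_2>0$, $\Phi(st)\le C_1\Phi(s)\Phi(t)$ for all $s,t>0$ and $$\Phi\left(\tfrac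 st\right)\le C_2\frac{\Phi(s)}{t^{q}}\quad\Big(\text{resp. }\ \Phi\left(\tfrac st\right)\le C_2\frac{s^{p}}{\Phi(t)}\Big)\qquad\text{for all } s,t\ge 1 .$$ Put $a_\Phi=\inf_{t>0}\frac{t\Phi'(t)}{\Phi(t)}$ and $b_\Phi=\sup_{t>0}\frac{t\Phi'(t)}{\Phi(t)}$. Let $\mathbb C_+$ be the upper half-plane. For $\alpha>-1$, $A^{\Phi}_\alpha(\mathbb C_+)$ is the set of analytic functions $F$ on $\mathbb C_+$ with $$\|F\|_{A^\Phi_\alpha}=\inf\Big\{\lambda>0:\int_{\mathbb C_+}\Phi\Big(\frac{|F(x+iy)|}{\lambda}\Big)y^\alpha\,dx\,dy\le 1\Big\}<\infty .$$ An analytic function $G$ on $\mathbb C_+$ is a multiplier from $A^{\Phi_1}_\alpha(\mathbb C_+)$ to $A^{\Phi_2}_\beta(\mathbb C_+)$ if there is $C>0$ such that, for all $F\in A^{\Phi_1}_\alpha(\mathbb C_+)$, $FG\in A^{\Phi_2}_\beta(\mathbb C_+)$ and $\|FG\|_{A^{\Phi_2}_\beta}\le C\|F\|_{A^{\Phi_1}_\alpha}$;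 let $\mathcal M(A^{\Phi_1}_\alpha,A^{\Phi_2}_\beta)$ be the set of these multipliers. For $\omega:(0,\infty)\to(0,\infty)$, $H^\infty_\omega(\mathbb C_+)$ is the set of analytic functions $F$ on $\mathbb C_+$ with $\sup_{z\in\mathbb C_+}|F(z)|/\omega(\operatorname{Im}z)<\infty$, and $H^\infty(\mathbb C_+)$ is the set of bounded analytic functions on $\mathbb C_+$. **Theorem.** Let $\Phi_1\in\mathscr L\cup\mathscr U$ and $\Phi_2\in\widetilde{\mathscr L}\cup\widetilde{\mathscr U}$ be such that $t\mapsto\Phi_2(t)/\Phi_1(t)$ is nondecreasing on $(0,\infty)$. Let $\alpha,\beta>-1$ and $$\omega(t)=\frac{\Phi_2^{-1}\left(t^{-2-\beta}\right)}{\Phi_1^{-1}\left(t^{-2-\alpha}\right)},\qquad t>0 .$$ 1. If $0<a_{\Phi_1}\le b_{\Phi_1}<a_{\Phi_2}\le b_{\Phi_2}<\infty$, then $\mathcal M(A^{\Phi_1}_\alpha,A^{\Phi_2}_\beta)=H^\infty_\omega(\mathbb C_+)$. 2. If $\omega\approx 1$, that is, $c^{-1}\le\omega(t)\le c$ for some $c>0$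 and all $t>0$, then $\mathcal M(A^{\Phi_1}_\alpha,A^{\Phi_2}_\beta)=H^\infty(\mathbb C_+)$. 3. If $\lim_{t\to0^+}\omega(t)=0$ (in particular, if $\omega(t)$ decreases to $0$ as $t\downarrow 0$), then $\mathcal M(A^{\Phi_1}_\alpha,A^{\Phi_2}_\beta)=\{0\}$. -/

import Mathlib

open Set Filter Topology MeasureTheory
open scoped UpperHalfPlane Manifold ENNReal

noncomputable section

namespace BergmanOrlicz

/-- A growth function: a continuous nondecreasing map of `[0, ∞)` onto itself.  It is represented
by a map `ℝ → ℝ`, of which only the values on `[0, ∞)` are ever used. -/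
structure IsGrowth (Φ : ℝ → ℝ) : Prop where
  continuousOn : ContinuousOn Φ (Ici 0)
  monotoneOn : MonotoneOn Φ (Ici 0)
  image_eq : Φ '' Ici 0 = Ici 0

/-- `Φ` is of upper type `p`. -/
def UpperType (p : ℝ) (Φ : ℝ → ℝ) : Prop :=
  ∃ C : ℝ, 0 < C ∧ ∀ t : ℝ, 1 ≤ t → ∀ s : ℝ, 0 < s → Φ (s * t) ≤ C * t ^ p * Φ s

/-- `Φ` is of lower type `p`. -/
def LowerType (p : ℝ) (Φ : ℝ → ℝ) : Prop :=
  ∃ C : ℝ, 0 < C ∧ ∀ t : ℝ, 0 < t → t ≤ 1 → ∀ s : ℝ, 0 < s → Φ (s * t) ≤ C * t ^ p * Φ s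

/-- The class `𝒰^p`, `p ≥ 1`; its members are, by convention, convex and continuously
differentiable on `(0, ∞)`. -/
structure ClassUp (p : ℝ) (Φ : ℝ → ℝ) : Prop where
  growth : IsGrowth Φ
  one_le : 1 ≤ p
  upperType : UpperType p Φ
  div_mono : MonotoneOn (fun t => Φ t / t) (Ioi 0)
  contDiffOn : ContDiffOn ℝ 1 Φ (Ioi 0)
  convexOn : ConvexOn ℝ (Ici 0) Φ

/-- The class `ℒ_p`, `0 < p ≤ 1`; its members are, by convention, concave and continuously
differentiable on `(0, ∞)`. (At `0` the derivative may be infinite, as for `t ↦ t ^ p`.) -/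
structure ClassLow (p : ℝ) (Φ : ℝ → ℝ) : Prop where
  growth : IsGrowth Φ
  pos : 0 < p
  le_one : p ≤ 1
  lowerType : LowerType p Φ
  div_anti : AntitoneOn (fun t => Φ t / t) (Ioi 0)
  contDiffOn : ContDiffOn ℝ 1 Φ (Ioi 0)
  concaveOn : ConcaveOn ℝ (Ici 0) Φ

/-- `Φ ∈ ℒ ∪ 𝒰`. -/
def MemLU (Φ : ℝ → ℝ) : Prop :=
  (∃ p, ClassLow p Φ) ∨ (∃ p, ClassUp p Φ)

/-- `Φ (s t) ≤ C Φ (s) Φ (t)` for all `s, t > 0`. -/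
def SubMult (Φ : ℝ → ℝ) : Prop :=
  ∃ C : ℝ, 0 < C ∧ ∀ s t : ℝ, 0 < s → 0 < t → Φ (s * t) ≤ C * (Φ s * Φ t)

/-- The class `𝒰̃^q`. -/
structure ClassUpTilde (q : ℝ) (Φ : ℝ → ℝ) : Prop where
  mem : ClassUp q Φ
  subMult : SubMult Φ
  div_le : ∃ C : ℝ, 0 < C ∧ ∀ s t : ℝ, 1 ≤ s → 1 ≤ t → Φ (s / t) ≤ C * (Φ s / t ^ q)

/-- The class `ℒ̃_p`. -/
structure ClassLowTilde (p : ℝ) (Φ : ℝ → ℝ) : Prop where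
  mem : ClassLow p Φ
  subMult : SubMult Φ
  div_le : ∃ C : ℝ, 0 < C ∧ ∀ s t : ℝ, 1 ≤ s → 1 ≤ t → Φ (s / t) ≤ C * (s ^ p / Φ t)

/-- `Φ ∈ ℒ̃ ∪ 𝒰̃`. -/
def MemLUTilde (Φ : ℝ → ℝ) : Prop :=
  (∃ p, ClassLowTilde p Φ) ∨ (∃ q, ClassUpTilde q Φ)

/-- The lower index `a_Φ = inf_{t > 0} t Φ'(t) / Φ(t)`. -/
def lowerIndex (Φ : ℝ → ℝ) : EReal :=
  ⨅ t : Ioi (0 : ℝ), (((t : ℝ) * deriv Φ t / Φ t : ℝ) : EReal)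

/-- The upper index `b_Φ = sup_{t > 0} t Φ'(t) / Φ(t)`. -/
def upperIndex (Φ : ℝ → ℝ) : EReal :=
  ⨆ t : Ioi (0 : ℝ), (((t : ℝ) * deriv Φ t / Φ t : ℝ) : EReal)

/-- The inverse of `Φ` as a map of `[0, ∞)` onto itself. -/
def growthInv (Φ : ℝ → ℝ) : ℝ → ℝ :=
  Function.invFunOn Φ (Ici 0)

/-- The measure `dV_α (x + i y) = y ^ α dx dy` on the upper half-plane (here `volume` is the
Lebesgue measure of `ℂ`). -/
def weightedArea (α : ℝ) : Measure ℍ :=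
  ((volume : Measure ℂ).comap UpperHalfPlane.coe).withDensity
    fun z => ENNReal.ofReal (z.im ^ α)

/-- The analytic functions on the upper half-plane. -/
def Analytic (F : ℍ → ℂ) : Prop :=
  MDifferentiable 𝓘(ℂ) 𝓘(ℂ) F

/-- The Luxemburg gauge
`‖F‖ = inf {l > 0 : ∫ Φ (|F| / l) dV_α ≤ 1}`, equal to `∞` if there is no such `l`. -/
def luxNorm (Φ : ℝ → ℝ) (α : ℝ) (F : ℍ → ℂ) : ℝ≥0∞ :=
  ⨅ (l : ℝ) (_ : 0 < l ∧ ∫⁻ z, ENNReal.ofReal (Φ (‖F z‖ / l)) ∂(weightedArea α) ≤ 1),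
    ENNReal.ofReal l

/-- The Bergman-Orlicz space `A_α^Φ(ℂ₊)`. -/
def bergmanOrlicz (Φ : ℝ → ℝ) (α : ℝ) : Set (ℍ → ℂ) :=
  {F | Analytic F ∧ luxNorm Φ α F < ∞}

/-- The pointwise multipliers from `A_α^{Φ₁}(ℂ₊)` to `A_β^{Φ₂}(ℂ₊)`. -/
def multipliers (Φ₁ : ℝ → ℝ) (α : ℝ) (Φ₂ : ℝ → ℝ) (β : ℝ) : Set (ℍ → ℂ) :=
  {G | Analytic G ∧ ∃ C : ℝ, 0 < C ∧ ∀ F ∈ bergmanOrlicz Φ₁ α,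
    F * G ∈ bergmanOrlicz Φ₂ β ∧ luxNorm Φ₂ β (F * G) ≤ ENNReal.ofReal C * luxNorm Φ₁ α F}

/-- The space `H^∞_ω(ℂ₊)`: analytic functions with `sup_z |F z| / ω (Im z) < ∞`. -/
def weightedHInfty (ω : ℝ → ℝ) : Set (ℍ → ℂ) :=
  {F | Analytic F ∧ BddAbove (range fun z : ℍ => ‖F z‖ / ω z.im)}

/-- The space `H^∞(ℂ₊)` of bounded analytic functions. -/
def hInfty : Set (ℍ → ℂ) :=
  {F | Analytic F ∧ BddAbove (range fun z : ℍ => ‖F z‖)}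

/-- `ω(t) = Φ₂⁻¹(1 / t^(2+β)) / Φ₁⁻¹(1 / t^(2+α))`. -/
def multWeight (Φ₁ : ℝ → ℝ) (α : ℝ) (Φ₂ : ℝ → ℝ) (β : ℝ) (t : ℝ) : ℝ :=
  growthInv Φ₂ (1 / t ^ (2 + β)) / growthInv Φ₁ (1 / t ^ (2 + α))

end BergmanOrlicz

end

namespace BergmanOrlicz

/-- Growth functions of positive lower type `p` and of finite upper type `q`. -/
structure PowerBounded (Φ : ℝ → ℝ) (p q C : ℝ) : Prop where
  growth : IsGrowth Φ
  lower_pos : 0 < p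
  one_le : 1 ≤ C
  lower : ∀ t : ℝ, 0 < t → t ≤ 1 → ∀ s : ℝ, 0 < s → Φ (s * t) ≤ C * t ^ p * Φ s
  upper : ∀ t : ℝ, 1 ≤ t → ∀ s : ℝ, 0 < s → Φ (s * t) ≤ C * t ^ q * Φ s

namespace IsGrowth

variable {Φ : ℝ → ℝ}

theorem nonneg (h : IsGrowth Φ) {x : ℝ} (hx : 0 ≤ x) : 0 ≤ Φ x := by
  have : Φ x ∈ Φ '' Ici 0 := ⟨x, hx, rfl⟩
  rwa [h.image_eq] at this

theorem le_of_le (h : IsGrowth Φ) {x y : ℝ} (hx : 0 ≤ x) (hxy : x ≤ y) : Φ x ≤ Φ y :=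
  h.monotoneOn hx (hx.trans hxy) hxy

theorem map_zero (h : IsGrowth Φ) : Φ 0 = 0 := by
  have h0 : (0 : ℝ) ∈ Φ '' Ici 0 := by rw [h.image_eq]; exact le_refl (0 : ℝ)
  obtain ⟨x, hx, hx0⟩ := h0
  have := h.le_of_le (le_refl (0:ℝ)) hx
  exact le_antisymm (hx0 ▸ this) (h.nonneg le_rfl)

theorem growthInv_mem (h : IsGrowth Φ) {y : ℝ} (hy : 0 ≤ y) : 0 ≤ growthInv Φ y := by
  have : ∃ a ∈ Ici (0 : ℝ), Φ a = y := by
    have : y ∈ Φ '' Ici 0 := by rw [h.image_eq]; exact hy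
    exact this
  exact Function.invFunOn_mem this

theorem map_growthInv (h : IsGrowth Φ) {y : ℝ} (hy : 0 ≤ y) : Φ (growthInv Φ y) = y := by
  have : ∃ a ∈ Ici (0 : ℝ), Φ a = y := by
    have : y ∈ Φ '' Ici 0 := by rw [h.image_eq]; exact hy
    exact this
  exact Function.invFunOn_eq this

theorem growthInv_pos (h : IsGrowth Φ) {y : ℝ} (hy : 0 < y) : 0 < growthInv Φ y := by
  rcases (h.growthInv_mem hy.le).eq_or_lt with h0 | h0
  · have := h.map_growthInv hy.le
    rw [← h0, h.map_zero] at this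
    exact absurd this hy.ne
  · exact h0

theorem growthInv_mono (h : IsGrowth Φ) {x y : ℝ} (hx : 0 ≤ x) (hxy : x ≤ y) :
    growthInv Φ x ≤ growthInv Φ y := by
  rcases hxy.eq_or_lt with rfl | hlt
  · exact le_rfl
  by_contra! hc
  have := h.le_of_le (h.growthInv_mem (hx.trans hxy)) hc.le
  rw [h.map_growthInv hx, h.map_growthInv (hx.trans hxy)] at this
  exact absurd this (not_le.2 hlt)

theorem multWeight_pos {Ψ : ℝ → ℝ} (h : IsGrowth Φ) (h' : IsGrowth Ψ) {α β t : ℝ} (ht : 0 < t) :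
    0 < multWeight Φ α Ψ β t :=
  div_pos (h'.growthInv_pos (by positivity)) (h.growthInv_pos (by positivity))

end IsGrowth

namespace PowerBounded

variable {Φ : ℝ → ℝ} {p q C : ℝ}

theorem pos_of_pos (h : PowerBounded Φ p q C) {x : ℝ} (hx : 0 < x) : 0 < Φ x := by
  refine (h.growth.nonneg hx.le).lt_of_ne fun h0 => ?_
  have h1 : (1 : ℝ) ∈ Φ '' Ici 0 := by rw [h.growth.image_eq]; exact zero_le_one (α := ℝ)
  obtain ⟨y, hy, hy1⟩ := h1
  have h2 := h.upper (max 1 (y / x)) (le_max_left _ _) x hx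
  rw [← h0, mul_zero] at h2
  have h3 : y ≤ x * max 1 (y / x) := by
    calc y = x * (y / x) := by field_simp
      _ ≤ _ := by gcongr; exact le_max_right _ _
  have h4 := h.growth.le_of_le hy h3
  linarith

theorem exists_dilate_le (h : PowerBounded Φ p q C) {K : ℝ} (hK : 0 < K) :
    ∃ D : ℝ, 0 < D ∧ ∀ x, 0 ≤ x → Φ (K * x) ≤ D * Φ x := by
  have hC := h.one_le
  refine ⟨C * (max 1 K) ^ q, by positivity, fun x hx => ?_⟩
  rcases hx.eq_or_lt with rfl | hx
  · simp [h.growth.map_zero]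
  calc Φ (K * x) ≤ Φ (x * max 1 K) := by
        refine h.growth.le_of_le (by positivity) ?_
        rw [mul_comm]; gcongr; exact le_max_right _ _
    _ ≤ _ := h.upper _ (le_max_left _ _) x hx

theorem exists_shrink_le (h : PowerBounded Φ p q C) {ε : ℝ} (hε : 0 < ε) :
    ∃ δ : ℝ, 0 < δ ∧ δ ≤ 1 ∧ ∀ x, 0 ≤ x → Φ (δ * x) ≤ ε * Φ x := by
  have hC := h.one_le
  have hp := h.lower_pos
  have hε' : 0 < ε / C := by positivity
  refine ⟨min 1 ((ε / C) ^ p⁻¹), by positivity, min_le_left _ _, fun x hx => ?_⟩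
  rcases hx.eq_or_lt with rfl | hx
  · simp [h.growth.map_zero]
  set δ := min 1 ((ε / C) ^ p⁻¹) with hδ
  have hδ0 : 0 < δ := by positivity
  have hpow : δ ^ p ≤ ε / C := by
    calc δ ^ p ≤ ((ε / C) ^ p⁻¹) ^ p := by gcongr; exact min_le_right _ _
      _ = ε / C := Real.rpow_inv_rpow hε'.le hp.ne'
  rw [mul_comm]
  calc Φ (x * δ) ≤ C * δ ^ p * Φ x := h.lower _ hδ0 (min_le_left _ _) x hx
    _ ≤ C * (ε / C) * Φ x := by
      gcongr
      exact h.growth.nonneg hx.le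
    _ = ε * Φ x := by field_simp

theorem exists_le_of_map_le (h : PowerBounded Φ p q C) {K : ℝ} (hK : 0 < K) :
    ∃ D : ℝ, 0 < D ∧ ∀ x y, 0 ≤ x → 0 ≤ y → Φ x ≤ K * Φ y → x ≤ D * y := by
  obtain ⟨δ, hδ, -, hs⟩ := h.exists_shrink_le (ε := (2 * K)⁻¹) (by positivity)
  refine ⟨δ⁻¹, by positivity, fun x y hx hy hxy => ?_⟩
  by_contra! hc
  have hyx : y ≤ δ * x := by
    rw [inv_mul_lt_iff₀ hδ] at hc; exact hc.le
  have hx0 : 0 < x := lt_of_le_of_lt (by positivity) hc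
  have h1 := (h.growth.le_of_le hy hyx).trans (hs x hx)
  have h2 := h.pos_of_pos hx0
  have : K * Φ y ≤ K * ((2 * K)⁻¹ * Φ x) := by gcongr
  have h3 : K * ((2 * K)⁻¹ * Φ x) = Φ x / 2 := by field_simp
  linarith

end PowerBounded

theorem ClassLow.exists_powerBounded {p : ℝ} {Φ : ℝ → ℝ} (h : ClassLow p Φ) :
    ∃ C, PowerBounded Φ p 1 C := by
  obtain ⟨C, hC, hl⟩ := h.lowerType
  refine ⟨max 1 C, h.growth, h.pos, le_max_left _ _, fun t ht ht1 s hs => ?_,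
    fun t ht s hs => ?_⟩
  · refine (hl t ht ht1 s hs).trans ?_
    have := h.growth.nonneg hs.le
    gcongr
    exact le_max_right _ _
  · have ht0 : 0 < t := one_pos.trans_le ht
    have h1 := h.div_anti (mem_Ioi.2 hs) (mem_Ioi.2 (mul_pos hs ht0))
      (le_mul_of_one_le_right hs.le ht)
    simp only at h1
    rw [div_le_div_iff₀ (by positivity) hs] at h1
    have h2 : Φ (s * t) ≤ t * Φ s := by nlinarith
    have := h.growth.nonneg hs.le
    rw [Real.rpow_one, mul_assoc]
    exact h2.trans (le_mul_of_one_le_left (by positivity) (le_max_left _ _))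

theorem ClassUp.exists_powerBounded {p : ℝ} {Φ : ℝ → ℝ} (h : ClassUp p Φ) :
    ∃ C, PowerBounded Φ 1 p C := by
  obtain ⟨C, hC, hl⟩ := h.upperType
  refine ⟨max 1 C, h.growth, one_pos, le_max_left _ _,
    fun t ht ht1 s hs => ?_, fun t ht s hs => ?_⟩
  · have h1 := h.div_mono (mem_Ioi.2 (mul_pos hs ht)) (mem_Ioi.2 hs)
      (mul_le_of_le_one_right hs.le ht1)
    simp only at h1
    rw [div_le_div_iff₀ (by positivity) hs] at h1
    have h2 : Φ (s * t) ≤ t * Φ s := by nlinarith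
    have := h.growth.nonneg hs.le
    rw [Real.rpow_one, mul_assoc]
    exact h2.trans (le_mul_of_one_le_left (by positivity) (le_max_left _ _))
  · refine (hl t ht s hs).trans ?_
    have := h.growth.nonneg hs.le
    gcongr
    exact le_max_right _ _

theorem MemLU.exists_powerBounded {Φ : ℝ → ℝ} (h : MemLU Φ) : ∃ p q C, PowerBounded Φ p q C := by
  rcases h with ⟨_, h⟩ | ⟨_, h⟩
  · exact ⟨_, _, _, h.exists_powerBounded.choose_spec⟩
  · exact ⟨_, _, _, h.exists_powerBounded.choose_spec⟩

theorem MemLUTilde.memLU {Φ : ℝ → ℝ} (h : MemLUTilde Φ) : MemLU Φ :=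
  Or.imp (Exists.imp fun _ h => h.mem) (Exists.imp fun _ h => h.mem) h

theorem MemLU.differentiableOn {Φ : ℝ → ℝ} (h : MemLU Φ) : DifferentiableOn ℝ Φ (Ioi 0) := by
  rcases h with ⟨p, h⟩ | ⟨p, h⟩
  · exact h.contDiffOn.differentiableOn one_ne_zero
  · exact h.contDiffOn.differentiableOn one_ne_zero

theorem hasDerivAt_log_sub {Φ : ℝ → ℝ} (hd : DifferentiableOn ℝ Φ (Ioi 0))
    (hpos : ∀ x, 0 < x → 0 < Φ x) {a x : ℝ} (hx : 0 < x) :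
    HasDerivAt (fun t => Real.log (Φ t) - a * Real.log t) (deriv Φ x / Φ x - a * x⁻¹) x :=
  (((hd x hx).differentiableAt (Ioi_mem_nhds hx)).hasDerivAt.log (hpos x hx).ne').sub
    ((Real.hasDerivAt_log hx.ne').const_mul a)

theorem map_mul_le_of_le_lowerIndex {Φ : ℝ → ℝ} (hd : DifferentiableOn ℝ Φ (Ioi 0))
    (hpos : ∀ x, 0 < x → 0 < Φ x) {a : ℝ} (ha : (a : EReal) ≤ lowerIndex Φ) {s τ : ℝ}
    (hs : 0 < s) (hτ : 0 < τ) (hτ1 : τ ≤ 1) : Φ (τ * s) ≤ τ ^ a * Φ s := by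
  have hmono : MonotoneOn (fun t => Real.log (Φ t) - a * Real.log t) (Ioi 0) := by
    refine monotoneOn_of_deriv_nonneg (convex_Ioi 0)
      (fun x hx => (hasDerivAt_log_sub hd hpos hx).continuousAt.continuousWithinAt) ?_ ?_
    · rw [interior_Ioi]
      exact fun x hx => (hasDerivAt_log_sub hd hpos hx).differentiableAt.differentiableWithinAt
    · rw [interior_Ioi]
      intro x hx
      have hx0 : 0 < x := hx
      have h1 : (a : EReal) ≤ ((x * deriv Φ x / Φ x : ℝ) : EReal) :=
        ha.trans
          (iInf_le (fun t : Ioi (0 : ℝ) => (((t : ℝ) * deriv Φ t / Φ t : ℝ) : EReal)) ⟨x, hx⟩)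
      rw [EReal.coe_le_coe_iff] at h1
      rw [(hasDerivAt_log_sub hd hpos hx).deriv, sub_nonneg, ← div_eq_mul_inv, div_le_iff₀ hx0]
      exact h1.trans_eq (by ring)
  have h1 := hmono (mem_Ioi.2 (mul_pos hτ hs)) (mem_Ioi.2 hs) (mul_le_of_le_one_left hs.le hτ1)
  simp only at h1
  rw [Real.log_mul hτ.ne' hs.ne'] at h1
  have hΦs := hpos s hs
  rw [← Real.log_le_log_iff (hpos _ (mul_pos hτ hs)) (by positivity),
    Real.log_mul (by positivity) hΦs.ne', Real.log_rpow hτ]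
  linarith

theorem le_map_mul_of_upperIndex_le {Φ : ℝ → ℝ} (hd : DifferentiableOn ℝ Φ (Ioi 0))
    (hpos : ∀ x, 0 < x → 0 < Φ x) {a : ℝ} (ha : upperIndex Φ ≤ a) {s τ : ℝ}
    (hs : 0 < s) (hτ : 0 < τ) (hτ1 : τ ≤ 1) : τ ^ a * Φ s ≤ Φ (τ * s) := by
  have hmono : AntitoneOn (fun t => Real.log (Φ t) - a * Real.log t) (Ioi 0) := by
    refine antitoneOn_of_deriv_nonpos (convex_Ioi 0)
      (fun x hx => (hasDerivAt_log_sub hd hpos hx).continuousAt.continuousWithinAt) ?_ ?_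
    · rw [interior_Ioi]
      exact fun x hx => (hasDerivAt_log_sub hd hpos hx).differentiableAt.differentiableWithinAt
    · rw [interior_Ioi]
      intro x hx
      have hx0 : 0 < x := hx
      have h1 : ((x * deriv Φ x / Φ x : ℝ) : EReal) ≤ a :=
        (le_iSup (fun t : Ioi (0 : ℝ) => (((t : ℝ) * deriv Φ t / Φ t : ℝ) : EReal)) ⟨x, hx⟩).trans
          ha
      rw [EReal.coe_le_coe_iff] at h1
      rw [(hasDerivAt_log_sub hd hpos hx).deriv, sub_nonpos, ← div_eq_mul_inv, le_div_iff₀ hx0]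
      exact (by ring : _ = _).trans_le h1
  have h1 := hmono (mem_Ioi.2 (mul_pos hτ hs)) (mem_Ioi.2 hs) (mul_le_of_le_one_left hs.le hτ1)
  simp only at h1
  rw [Real.log_mul hτ.ne' hs.ne'] at h1
  have hΦs := hpos s hs
  rw [← Real.log_le_log_iff (by positivity) (hpos _ (mul_pos hτ hs)),
    Real.log_mul (by positivity) hΦs.ne', Real.log_rpow hτ]
  linarith

open Metric in
theorem two_pi_mul_norm_le_lintegral_circle {f : ℂ → ℂ} {c : ℂ} {r : ℝ} (hr : 0 < r)
    (hf : DiffContOnCl ℂ f (ball c r)) :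
    ENNReal.ofReal (2 * Real.pi) * ‖f c‖ₑ ≤
      ∫⁻ θ in Ioo (-Real.pi) Real.pi, ‖f (circleMap c r θ)‖ₑ := by
  have h := DiffContOnCl.circleAverage (by rwa [abs_of_pos hr] : DiffContOnCl ℂ f (ball c |r|))
  rw [Real.circleAverage] at h
  have hper : Function.Periodic (fun θ => f (circleMap c r θ)) (2 * Real.pi) :=
    (periodic_circleMap c r).comp f
  have h2 := hper.intervalIntegral_add_eq 0 (-Real.pi)
  rw [zero_add, show -Real.pi + 2 * Real.pi = Real.pi by ring] at h2
  rw [h2] at h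
  have hpi := Real.pi_pos
  rw [intervalIntegral.integral_of_le (by linarith), integral_Ioc_eq_integral_Ioo,
    inv_smul_eq_iff₀ (by positivity)] at h
  calc ENNReal.ofReal (2 * Real.pi) * ‖f c‖ₑ = ‖(2 * Real.pi) • f c‖ₑ := by
        rw [enorm_smul, Real.enorm_of_nonneg (by positivity)]
    _ ≤ _ := by rw [← h]; exact enorm_integral_le_lintegral_enorm _

open Metric in
theorem volume_ball_mul_norm_le_lintegral {f : ℂ → ℂ} {c : ℂ} {R : ℝ}
    (hf : DifferentiableOn ℂ f (ball c R)) :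
    volume (ball c R) * ‖f c‖ₑ ≤ ∫⁻ w in ball c R, ‖f w‖ₑ := by
  have hpi := Real.pi_pos
  set g : ℂ → ℝ≥0∞ := fun w => (ball c R).indicator (fun w => ‖f w‖ₑ) (w + c) with hg
  have key : ∫⁻ w in ball c R, ‖f w‖ₑ = ∫⁻ w, g w := by
    rw [← lintegral_indicator measurableSet_ball, hg,
      lintegral_add_right_eq_self (fun w => (ball c R).indicator (fun w => ‖f w‖ₑ) w) c]
  rw [key, ← Complex.lintegral_comp_polarCoord_symm, polarCoord_target, Measure.volume_eq_prod,
    ← Measure.prod_restrict]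
  have hmeas : Measurable g := by
    have : Measurable ((ball c R).indicator fun w => ‖f w‖ₑ) := by
      classical
      rw [← piecewise_eq_indicator]
      exact hf.continuousOn.enorm.measurable_piecewise continuousOn_const measurableSet_ball
    exact this.comp (measurable_id.add_const c)
  rw [lintegral_prod]
  · have step : ∀ r ∈ Ioi (0 : ℝ), (Ioo 0 R).indicator
        (fun r => ENNReal.ofReal r * (ENNReal.ofReal (2 * Real.pi) * ‖f c‖ₑ)) r ≤
        ∫⁻ θ in Ioo (-Real.pi) Real.pi, ENNReal.ofReal r • g (Complex.polarCoord.symm (r, θ)) := by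
      intro r hr
      by_cases hrR : r < R
      · rw [indicator_of_mem (show r ∈ Ioo 0 R from ⟨hr, hrR⟩)]
        simp only [smul_eq_mul]
        rw [lintegral_const_mul' _ _ ENNReal.ofReal_ne_top]
        gcongr
        refine (two_pi_mul_norm_le_lintegral_circle (r := r) hr ?_).trans_eq ?_
        · exact (hf.mono (closedBall_subset_ball hrR)).diffContOnCl_ball subset_rfl
        · refine lintegral_congr fun θ => ?_
          have : (Complex.polarCoord.symm (r, θ) : ℂ) + c = circleMap c r θ := by
            rw [Complex.polarCoord_symm_apply, circleMap, Complex.exp_mul_I]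
            push_cast; ring
          simp only [hg]
          rw [this, indicator_of_mem]
          have : circleMap c r θ ∈ sphere c r := circleMap_mem_sphere _ (le_of_lt hr) _
          exact (mem_sphere.1 this).trans_lt hrR
      · rw [indicator_of_notMem (fun h => hrR h.2)]
        exact zero_le
    refine le_trans (le_of_eq ?_) (setLIntegral_mono' measurableSet_Ioi step)
    rw [lintegral_indicator measurableSet_Ioo, Measure.restrict_restrict measurableSet_Ioo,
      inter_eq_left.2 Ioo_subset_Ioi_self, lintegral_mul_const _ (by fun_prop),
      Complex.volume_ball, ← mul_assoc]
    congr 1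
    rcases le_or_gt R 0 with hR | hR
    · simp [hR]
    rw [← ofReal_integral_eq_lintegral_ofReal]
    · rw [← integral_Ioc_eq_integral_Ioo, ← intervalIntegral.integral_of_le hR.le, integral_id,
        ← ENNReal.ofReal_mul (by ring_nf; positivity), ← ENNReal.ofReal_pow hR.le,
        show (NNReal.pi : ℝ≥0∞) = ENNReal.ofReal Real.pi by
          rw [← NNReal.coe_real_pi, ENNReal.ofReal_coe_nnreal],
        ← ENNReal.ofReal_mul (by positivity)]
      congr 1; ring
    · exact (continuous_id.integrableOn_Icc).mono_set Ioo_subset_Icc_self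
    · exact (ae_restrict_mem measurableSet_Ioo).mono fun x hx => hx.1.le
  · refine Measurable.aemeasurable (Measurable.smul measurable_fst.ennreal_ofReal (hmeas.comp ?_))
    have : ⇑Complex.polarCoord.symm =
        fun p => (p.1 : ℂ) * (Real.cos p.2 + Real.sin p.2 * Complex.I) :=
      funext Complex.polarCoord_symm_apply
    rw [this]
    fun_prop

theorem IsGrowth.continuousOn_comp_norm {Φ : ℝ → ℝ} (h : IsGrowth Φ) {X : Type*}
    [TopologicalSpace X] {f : X → ℂ} {s : Set X} (hf : ContinuousOn f s) :
    ContinuousOn (fun w => Φ ‖f w‖) s :=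
  h.continuousOn.comp hf.norm fun _ _ => norm_nonneg _

open Metric in
/-- A quasi-mean-value inequality for `Φ ∘ ‖f‖`, `f` analytic. -/
theorem PowerBounded.exists_sq_mul_le_lintegral {Φ : ℝ → ℝ} {p q C : ℝ}
    (h : PowerBounded Φ p q C) :
    ∃ K : ℝ, 0 < K ∧ ∀ (f : ℂ → ℂ) (z : ℂ) (R : ℝ), 0 < R →
      ContinuousOn f (closedBall z R) → DifferentiableOn ℂ f (ball z R) →
      ENNReal.ofReal (R ^ 2 * Φ ‖f z‖) ≤
        ENNReal.ofReal K * ∫⁻ w in ball z R, ENNReal.ofReal (Φ ‖f w‖) := by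
  obtain ⟨D, hD, hdil⟩ := h.exists_dilate_le (K := 2) two_pos
  obtain ⟨E, hE, hcmp⟩ := h.exists_le_of_map_le (K := 4) (by norm_num)
  have hpi := Real.pi_pos
  refine ⟨8 * D * E / Real.pi, by positivity, fun f z R hR hfc hfd => ?_⟩
  obtain ⟨w, hw, hmax⟩ := (isCompact_closedBall z R).exists_isMaxOn
    ⟨z, mem_closedBall_self hR.le⟩
    (f := fun w => (R - dist w z) ^ 2 * Φ ‖f w‖)
    (((continuousOn_const.sub (continuous_id.dist continuous_const).continuousOn).pow 2).mul
      (h.growth.continuousOn_comp_norm hfc))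
  have hz := hmax (mem_closedBall_self hR.le)
  simp only [mem_ofPred_eq, dist_self, sub_zero] at hz
  rcases (mul_nonneg (sq_nonneg (R - dist w z)) (h.growth.nonneg (norm_nonneg (f w)))).eq_or_lt
    with h0 | h0
  · rw [ENNReal.ofReal_of_nonpos (hz.trans h0.symm.le)]
    exact zero_le
  set ρ := (R - dist w z) / 2 with hρ
  have hρ0 : 0 < ρ := by
    have h1 : R - dist w z ≠ 0 := fun h1 => by simp [h1] at h0
    have h2 : 0 ≤ R - dist w z := sub_nonneg.2 (mem_closedBall.1 hw)
    have := h2.lt_of_ne' h1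
    positivity
  have hd : R - dist w z = 2 * ρ := by rw [hρ]; ring
  rw [hd] at h0 hz
  have hsub : ball w ρ ⊆ ball z R := ball_subset_ball' (by linarith)
  have ha0 : 0 < ‖f w‖ := by
    refine (norm_nonneg _).lt_of_ne fun h1 => ?_
    rw [← h1, h.growth.map_zero, mul_zero] at h0
    exact h0.false
  set a := ‖f w‖ with ha
  have hΦa : 0 < Φ (a / 2) := h.pos_of_pos (by positivity)
  have hbound : ∀ v ∈ ball w ρ, ‖f v‖ ≤ a / 2 + E * a / Φ (a / 2) * Φ ‖f v‖ := by
    intro v hv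
    have hv' : v ∈ ball z R := hsub hv
    have hΦv := h.growth.nonneg (norm_nonneg (f v))
    have h1 := hmax (ball_subset_closedBall hv')
    simp only [mem_ofPred_eq] at h1
    rw [hd] at h1
    have h2 : ρ ≤ R - dist v z := by
      have := dist_triangle v w z
      have := mem_ball.1 hv
      linarith
    have h3 : ρ ^ 2 * Φ ‖f v‖ ≤ ρ ^ 2 * (4 * Φ a) := by
      calc ρ ^ 2 * Φ ‖f v‖ ≤ (R - dist v z) ^ 2 * Φ ‖f v‖ := by gcongr
        _ ≤ _ := h1.trans_eq (by ring)
    have h4 := hcmp _ _ (norm_nonneg _) ha0.le (le_of_mul_le_mul_left h3 (by positivity))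
    rcases le_total ‖f v‖ (a / 2) with h5 | h5
    · have : 0 ≤ E * a / Φ (a / 2) * Φ ‖f v‖ := by positivity
      linarith
    · have h6 := h.growth.le_of_le (by positivity) h5
      calc ‖f v‖ ≤ E * a * 1 := by linarith
        _ ≤ E * a * (Φ ‖f v‖ / Φ (a / 2)) := by
          gcongr
          rwa [one_le_div hΦa]
        _ = E * a / Φ (a / 2) * Φ ‖f v‖ := by ring
        _ ≤ _ := by linarith
  set I := ∫⁻ w in ball z R, ENNReal.ofReal (Φ ‖f w‖) with hI
  have hmean : volume (ball w ρ) * ENNReal.ofReal a ≤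
      ENNReal.ofReal (a / 2) * volume (ball w ρ) + ENNReal.ofReal (E * a / Φ (a / 2)) * I := by
    calc volume (ball w ρ) * ENNReal.ofReal a = volume (ball w ρ) * ‖f w‖ₑ := by
          rw [ha, ofReal_norm]
      _ ≤ ∫⁻ v in ball w ρ, ‖f v‖ₑ := volume_ball_mul_norm_le_lintegral (hfd.mono hsub)
      _ ≤ ∫⁻ v in ball w ρ, (ENNReal.ofReal (a / 2) +
          ENNReal.ofReal (E * a / Φ (a / 2)) * ENNReal.ofReal (Φ ‖f v‖)) := by
        refine setLIntegral_mono' measurableSet_ball fun v hv => ?_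
        rw [← ENNReal.ofReal_mul (by positivity), ← ENNReal.ofReal_add (by positivity)
          (mul_nonneg (by positivity) (h.growth.nonneg (norm_nonneg _))), ← ofReal_norm]
        exact ENNReal.ofReal_le_ofReal (hbound v hv)
      _ ≤ _ := by
        rw [lintegral_add_left measurable_const, setLIntegral_const,
          lintegral_const_mul' _ _ ENNReal.ofReal_ne_top]
        gcongr
        exact lintegral_mono_set hsub
  rcases eq_or_ne I ∞ with hItop | hItop
  · rw [hItop, ENNReal.mul_top]
    · exact le_top
    · rw [← pos_iff_ne_zero, ENNReal.ofReal_pos]; positivity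
  rw [← ENNReal.ofReal_toReal hItop] at hmean ⊢
  set i := I.toReal
  have hi : 0 ≤ i := ENNReal.toReal_nonneg
  rw [Complex.volume_ball, ← ENNReal.ofReal_pow hρ0.le,
    show (NNReal.pi : ℝ≥0∞) = ENNReal.ofReal Real.pi by
      rw [← NNReal.coe_real_pi, ENNReal.ofReal_coe_nnreal],
    ← ENNReal.ofReal_mul (by positivity), ← ENNReal.ofReal_mul (by positivity),
    ← ENNReal.ofReal_mul (by positivity), ← ENNReal.ofReal_mul (by positivity),
    ← ENNReal.ofReal_add (by positivity) (by positivity),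
    ENNReal.ofReal_le_ofReal_iff (by positivity)] at hmean
  rw [← ENNReal.ofReal_mul (by positivity)]
  refine ENNReal.ofReal_le_ofReal (hz.trans ?_)
  have h1 : ρ ^ 2 * Real.pi * Φ (a / 2) ≤ 2 * E * i := by
    have h2 : ρ ^ 2 * Real.pi * a / 2 ≤ E * a / Φ (a / 2) * i := by linarith
    rw [div_mul_eq_mul_div, le_div_iff₀ hΦa] at h2
    have : a * (ρ ^ 2 * Real.pi * Φ (a / 2)) ≤ a * (2 * E * i) := by linarith
    exact le_of_mul_le_mul_left this ha0
  have h2 : Φ a ≤ D * Φ (a / 2) := by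
    simpa [mul_div_cancel₀] using hdil (a / 2) (by positivity)
  calc (2 * ρ) ^ 2 * Φ a ≤ (2 * ρ) ^ 2 * (D * Φ (a / 2)) := by gcongr
    _ = 4 * D / Real.pi * (ρ ^ 2 * Real.pi * Φ (a / 2)) := by field_simp; ring
    _ ≤ 4 * D / Real.pi * (2 * E * i) := by gcongr
    _ = _ := by ring

open Metric

theorem range_coe_upperHalfPlane : range UpperHalfPlane.coe = {z : ℂ | 0 < z.im} := by
  ext z
  exact ⟨fun ⟨w, hw⟩ => hw ▸ w.im_pos, fun h => ⟨⟨z, h⟩, rfl⟩⟩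

theorem lintegral_weightedArea (α : ℝ) (g : ℍ → ℝ≥0∞) (hg : Measurable g) :
    ∫⁻ z, g z ∂weightedArea α =
      ∫⁻ w in {w : ℂ | 0 < w.im},
        ENNReal.ofReal (w.im ^ α) * g (UpperHalfPlane.ofComplex w) := by
  have hm : Measurable fun z : ℍ => ENNReal.ofReal (z.im ^ α) := by
    have : Measurable fun z : ℍ => z.im := UpperHalfPlane.continuous_im.measurable
    fun_prop
  rw [weightedArea, lintegral_withDensity_eq_lintegral_mul _ hm hg, ← range_coe_upperHalfPlane,
    ← UpperHalfPlane.measurableEmbedding_coe.map_comap,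
    UpperHalfPlane.measurableEmbedding_coe.lintegral_map]
  refine lintegral_congr fun z => ?_
  rw [UpperHalfPlane.ofComplex_apply]
  rfl

theorem Analytic.differentiableOn {F : ℍ → ℂ} (hF : Analytic F) :
    DifferentiableOn ℂ (F ∘ UpperHalfPlane.ofComplex) {z | 0 < z.im} :=
  UpperHalfPlane.mdifferentiable_iff.1 hF

theorem Analytic.continuous {F : ℍ → ℂ} (hF : Analytic F) : Continuous F :=
  MDifferentiable.continuous hF

theorem IsGrowth.measurable_comp_norm {Φ : ℝ → ℝ} (h : IsGrowth Φ) {F : ℍ → ℂ}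
    (hF : Continuous F) : Measurable fun z => ENNReal.ofReal (Φ ‖F z‖) := by
  have : Continuous fun z => Φ ‖F z‖ :=
    continuousOn_univ.1 (h.continuousOn_comp_norm hF.continuousOn)
  exact this.measurable.ennreal_ofReal

/-- Point evaluations on functions of modular at most one. -/
theorem PowerBounded.exists_norm_le_growthInv {Φ : ℝ → ℝ} {p q C : ℝ}
    (h : PowerBounded Φ p q C) (α : ℝ) :
    ∃ K : ℝ, 0 < K ∧ ∀ F : ℍ → ℂ, Analytic F →
      ∫⁻ z, ENNReal.ofReal (Φ ‖F z‖) ∂weightedArea α ≤ 1 →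
      ∀ z : ℍ, ‖F z‖ ≤ K * growthInv Φ (1 / z.im ^ (2 + α)) := by
  obtain ⟨A, hA, hmean⟩ := h.exists_sq_mul_le_lintegral
  -- a lower bound for the weight on the disc of radius `y / 2` about a point of height `y`
  obtain ⟨m, hm, hweight⟩ : ∃ m : ℝ, 0 < m ∧ ∀ y t : ℝ, 0 < y → y / 2 ≤ t → t ≤ 2 * y →
      m * y ^ α ≤ t ^ α := by
    refine ⟨min ((1 / 2) ^ α) (2 ^ α), by positivity, fun y t hy h1 h2 => ?_⟩
    rcases le_total 0 α with hα | hα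
    · calc min ((1 / 2) ^ α) (2 ^ α) * y ^ α ≤ (1 / 2) ^ α * y ^ α := by
            gcongr; exact min_le_left _ _
        _ = (y / 2) ^ α := by rw [← Real.mul_rpow (by norm_num) hy.le]; congr 1; ring
        _ ≤ t ^ α := by gcongr
    · calc min ((1 / 2) ^ α) (2 ^ α) * y ^ α ≤ 2 ^ α * y ^ α := by
            gcongr; exact min_le_right _ _
        _ = (2 * y) ^ α := by rw [← Real.mul_rpow (by norm_num) hy.le]
        _ ≤ t ^ α := Real.rpow_le_rpow_of_nonpos (by linarith) h2 hα
  obtain ⟨K, hK, hcmp⟩ := h.exists_le_of_map_le (K := 4 * A / m) (by positivity)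
  refine ⟨K, hK, fun F hF hmod z => ?_⟩
  have hy := z.im_pos
  set y := z.im with hydef
  have hu : 0 ≤ 1 / y ^ (2 + α) := by positivity
  refine hcmp _ _ (norm_nonneg _) (h.growth.growthInv_mem hu) ?_
  rw [h.growth.map_growthInv hu]
  have him : ∀ w ∈ closedBall (z : ℂ) (y / 2), y / 2 ≤ w.im ∧ w.im ≤ 2 * y := by
    intro w hw
    have h1 : |(w - z).im| ≤ y / 2 :=
      (Complex.abs_im_le_norm _).trans (by rwa [mem_closedBall, dist_eq_norm] at hw)
    rw [Complex.sub_im, abs_le] at h1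
    have : (z : ℂ).im = y := rfl
    constructor <;> linarith
  have hsub : closedBall (z : ℂ) (y / 2) ⊆ {w : ℂ | 0 < w.im} := fun w hw =>
    lt_of_lt_of_le (by positivity) (him w hw).1
  have h1 := hmean (F ∘ UpperHalfPlane.ofComplex) z (y / 2) (by positivity)
    (hF.differentiableOn.continuousOn.mono hsub)
    (hF.differentiableOn.mono (ball_subset_closedBall.trans hsub))
  rw [lintegral_weightedArea α _ (h.growth.measurable_comp_norm hF.continuous)] at hmod
  have h2 : ENNReal.ofReal (m * y ^ α) *
      ∫⁻ w in ball (z : ℂ) (y / 2), ENNReal.ofReal (Φ ‖(F ∘ UpperHalfPlane.ofComplex) w‖) ≤ 1 := by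
    rw [← lintegral_const_mul' _ _ ENNReal.ofReal_ne_top]
    refine le_trans ?_ ((lintegral_mono_set (ball_subset_closedBall.trans hsub)).trans hmod)
    refine setLIntegral_mono' measurableSet_ball fun w hw => ?_
    have := him w (ball_subset_closedBall hw)
    gcongr
    · exact hweight y _ hy this.1 this.2
    · rfl
  simp only [Function.comp_apply, UpperHalfPlane.ofComplex_apply] at h1
  have h3 : ENNReal.ofReal (m * y ^ α * ((y / 2) ^ 2 * Φ ‖F z‖)) ≤ ENNReal.ofReal A := by
    rw [ENNReal.ofReal_mul (by positivity)]
    refine (mul_le_mul_right h1 _).trans ?_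
    rw [mul_left_comm]
    exact (mul_le_mul_right h2 _).trans_eq (mul_one _)
  rw [ENNReal.ofReal_le_ofReal_iff hA.le] at h3
  rw [Real.rpow_add hy, Real.rpow_two]
  have hya : 0 < y ^ α := by positivity
  rw [div_mul_div_comm, mul_one, le_div_iff₀ (by positivity)]
  linarith

theorem lintegral_poisson_type {y : ℝ} (hy : 0 < y) (a : ℝ) :
    ∫⁻ x : ℝ, ENNReal.ofReal (y ^ 2 / (y ^ 2 + (x - a) ^ 2)) = ENNReal.ofReal (Real.pi * y) := by
  have heq : ∀ x : ℝ, y ^ 2 / (y ^ 2 + (x - a) ^ 2) = (1 + ((x - a) / y) ^ 2)⁻¹ := by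
    intro x
    field_simp
  simp_rw [heq]
  rw [← ofReal_integral_eq_lintegral_ofReal
    ((integrable_inv_one_add_sq.comp_div hy.ne').comp_sub_right a)
    (Eventually.of_forall fun x => by positivity),
    integral_sub_right_eq_self (fun x => (1 + (x / y) ^ 2)⁻¹) a,
    Measure.integral_comp_div (fun x => (1 + x ^ 2)⁻¹) y, integral_univ_inv_one_add_sq,
    abs_of_pos hy, smul_eq_mul, mul_comm]

theorem lintegral_Ioi_rpow_mul_div_rpow {α y : ℝ} (hα : -1 < α) (hy : 0 < y) :
    ∫⁻ t in Ioi (0 : ℝ), ENNReal.ofReal (t ^ α * (y / (t + y)) ^ (α + 2)) =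
      ENNReal.ofReal (y ^ (α + 1) / (α + 1)) := by
  have hα' : 0 < α + 1 := by linarith
  set g : ℝ → ℝ := fun t => y ^ (α + 1) / (α + 1) * (t / (t + y)) ^ (α + 1) with hg
  have hcont : ContinuousWithinAt g (Ici 0) 0 := by
    refine ContinuousAt.continuousWithinAt ?_
    refine continuousAt_const.mul (ContinuousAt.rpow_const ?_ (Or.inr hα'.le))
    exact continuousAt_id.div (by fun_prop) (by simpa using hy.ne')
  have hderiv : ∀ t ∈ Ioi (0 : ℝ), HasDerivAt g (t ^ α * (y / (t + y)) ^ (α + 2)) t := by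
    intro t ht
    have ht0 : 0 < t := ht
    have h1 : HasDerivAt (fun t => t / (t + y)) ((1 * (t + y) - t * 1) / (t + y) ^ 2) t :=
      (hasDerivAt_id t).div ((hasDerivAt_id t).add_const y) (by positivity)
    have h2 := (h1.rpow_const (p := α + 1) (Or.inl (by positivity))).const_mul
      (y ^ (α + 1) / (α + 1))
    refine h2.congr_deriv (Eq.symm ?_)
    rw [show α + 1 - 1 = α by ring, Real.div_rpow ht0.le (by positivity),
      Real.div_rpow hy.le (by positivity), show α + 2 = α + 1 + 1 by ring,
      Real.rpow_add_one hy.ne' (α + 1), Real.rpow_add_one (x := t + y) (by positivity) (α + 1),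
      Real.rpow_add_one (x := t + y) (by positivity) α]
    have : (t + y) ^ α ≠ 0 := by positivity
    field_simp
    ring
  have hnn : ∀ t ∈ Ioi (0 : ℝ), 0 ≤ t ^ α * (y / (t + y)) ^ (α + 2) := by
    intro t ht
    have ht0 : 0 < t := ht
    positivity
  have hlim : Tendsto g atTop (𝓝 (y ^ (α + 1) / (α + 1) * 1 ^ (α + 1))) := by
    refine Tendsto.const_mul _ (Tendsto.rpow_const ?_ (Or.inr hα'.le))
    have h1 : Tendsto (fun t : ℝ => 1 - y / (t + y)) atTop (𝓝 (1 - 0)) :=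
      tendsto_const_nhds.sub
        (tendsto_const_nhds.div_atTop (tendsto_atTop_add_const_right _ _ tendsto_id))
    rw [sub_zero] at h1
    refine h1.congr' ?_
    filter_upwards [eventually_gt_atTop 0] with t ht
    have : t + y ≠ 0 := by positivity
    field_simp
    ring
  rw [← ofReal_integral_eq_lintegral_ofReal
    (integrableOn_Ioi_deriv_of_nonneg hcont hderiv hnn hlim)
    ((ae_restrict_mem measurableSet_Ioi).mono hnn),
    integral_Ioi_of_hasDerivAt_of_nonneg hcont hderiv hnn hlim]
  simp [hg, Real.zero_rpow hα'.ne']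

theorem setLIntegral_upperHalfPlane_mul {f g : ℝ → ℝ≥0∞} (hf : Measurable f) (hg : Measurable g) :
    ∫⁻ w in {w : ℂ | 0 < w.im}, f w.re * g w.im = (∫⁻ x, f x) * ∫⁻ t in Ioi 0, g t := by
  have h := Complex.volume_preserving_equiv_real_prod.setLIntegral_comp_preimage_emb
    Complex.measurableEquivRealProd.measurableEmbedding
    (fun v : ℝ × ℝ => f v.1 * g v.2) (univ ×ˢ Ioi 0)
  rw [Measure.volume_eq_prod, ← Measure.prod_restrict, Measure.restrict_univ,
    lintegral_prod_mul hf.aemeasurable hg.aemeasurable] at h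
  rw [← h]
  congr 2
  ext w
  simp [Complex.measurableEquivRealProd_apply]

theorem setLIntegral_rpow_div_norm_le {α y : ℝ} (hα : -1 < α) (hy : 0 < y) (a : ℝ) :
    ∫⁻ w in {w : ℂ | 0 < w.im}, ENNReal.ofReal (w.im ^ α) *
      ENNReal.ofReal ((y / ‖w - (a - y * Complex.I)‖) ^ (α + 4)) ≤
      ENNReal.ofReal (Real.pi / (α + 1) * y ^ (2 + α)) := by
  have hpi := Real.pi_pos
  have hα' : 0 < α + 1 := by linarith
  calc _ ≤ ∫⁻ w in {w : ℂ | 0 < w.im}, ENNReal.ofReal (y ^ 2 / (y ^ 2 + (w.re - a) ^ 2)) *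
        ENNReal.ofReal (w.im ^ α * (y / (w.im + y)) ^ (α + 2)) := by
        refine setLIntegral_mono' (measurableSet_lt measurable_const Complex.measurable_im) ?_
        intro w hw
        have hw0 : 0 < w.im := hw
        rw [← ENNReal.ofReal_mul (by positivity), ← ENNReal.ofReal_mul (by positivity)]
        refine ENNReal.ofReal_le_ofReal ?_
        set T := ‖w - (a - y * Complex.I)‖
        have hsq : T ^ 2 = (w.re - a) ^ 2 + (w.im + y) ^ 2 := by
          rw [Complex.sq_norm, Complex.normSq_apply]
          simp; ring
        have hT1 : w.im + y ≤ T :=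
          (pow_le_pow_iff_left₀ (by positivity) (norm_nonneg _) two_ne_zero).1
            (by nlinarith [sq_nonneg (w.re - a)])
        have hT0 : 0 < T := lt_of_lt_of_le (by positivity) hT1
        have hT2 : y ^ 2 + (w.re - a) ^ 2 ≤ T ^ 2 := by nlinarith
        calc w.im ^ α * (y / T) ^ (α + 4) = (y ^ 2 / T ^ 2) * (w.im ^ α * (y / T) ^ (α + 2)) := by
              rw [show α + 4 = α + 2 + 2 by ring, Real.rpow_add (by positivity) (α + 2) 2,
                Real.rpow_two]
              ring
          _ ≤ _ := by
            have : 0 ≤ α + 2 := by linarith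
            gcongr
    _ = ENNReal.ofReal (Real.pi * y) * ENNReal.ofReal (y ^ (α + 1) / (α + 1)) := by
        rw [← lintegral_poisson_type hy a, ← lintegral_Ioi_rpow_mul_div_rpow hα hy]
        exact setLIntegral_upperHalfPlane_mul
          (f := fun x => ENNReal.ofReal (y ^ 2 / (y ^ 2 + (x - a) ^ 2)))
          (g := fun t => ENNReal.ofReal (t ^ α * (y / (t + y)) ^ (α + 2)))
          (by fun_prop) (by fun_prop)
    _ ≤ _ := by
        rw [← ENNReal.ofReal_mul (by positivity)]
        refine ENNReal.ofReal_le_ofReal (le_of_eq ?_)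
        rw [show 2 + α = α + 1 + 1 by ring, Real.rpow_add_one hy.ne' (α + 1)]
        ring

/-- Test functions of modular at most one, of extremal size at a given point. -/
theorem PowerBounded.exists_testFunction {Φ : ℝ → ℝ} {p q C : ℝ} (h : PowerBounded Φ p q C)
    {α : ℝ} (hα : -1 < α) :
    ∃ c : ℝ, 0 < c ∧ ∀ z : ℍ, ∃ F : ℍ → ℂ, Analytic F ∧
      ∫⁻ w, ENNReal.ofReal (Φ ‖F w‖) ∂weightedArea α ≤ 1 ∧
      ‖F z‖ = c * growthInv Φ (1 / z.im ^ (2 + α)) := by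
  have hpi := Real.pi_pos
  have hα' : 0 < α + 1 := by linarith
  have hC : 0 < C := one_pos.trans_le h.one_le
  have hp := h.lower_pos
  obtain ⟨N, hN⟩ := exists_nat_ge ((α + 4) / p)
  rw [div_le_iff₀ hp] at hN
  obtain ⟨δ, hδ, -, hshrink⟩ := h.exists_shrink_le
    (ε := (C * (Real.pi / (α + 1)))⁻¹) (by positivity)
  refine ⟨δ * (1 / 2) ^ N, by positivity, fun z => ?_⟩
  have hy := z.im_pos
  set y := z.im with hydef
  have hu0 : 0 < 1 / y ^ (2 + α) := by positivity
  set u := growthInv Φ (1 / y ^ (2 + α)) with hu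
  have hupos : 0 < u := h.growth.growthInv_pos hu0
  have hΦu : Φ u = 1 / y ^ (2 + α) := h.growth.map_growthInv hu0.le
  set b : ℂ := z.re - y * Complex.I with hb
  have him : ∀ w : ℂ, 0 < w.im → y ≤ ‖w - b‖ := by
    intro w hw
    have h1 := Complex.abs_im_le_norm (w - b)
    have h2 : (w - b).im = w.im + y := by simp [hb]
    rw [h2] at h1
    have := le_abs_self (w.im + y)
    linarith
  set F : ℍ → ℂ := fun w => δ * u * (y / ((w : ℂ) - b)) ^ N with hF
  have hnorm : ∀ w : ℍ, ‖F w‖ = δ * (u * (y / ‖(w : ℂ) - b‖) ^ N) := by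
    intro w
    simp [hF, abs_of_pos hδ, abs_of_pos hupos, abs_of_pos hy, mul_assoc]
  have hFan : Analytic F := by
    refine UpperHalfPlane.mdifferentiable_iff.2 ?_
    refine DifferentiableOn.congr (f := fun w : ℂ => δ * u * (y / (w - b)) ^ N) ?_ ?_
    · intro w hw
      have : w - b ≠ 0 := norm_pos_iff.1 (hy.trans_le (him w hw))
      exact DifferentiableAt.differentiableWithinAt (by fun_prop (disch := assumption))
    · intro w hw
      have : ((UpperHalfPlane.ofComplex w : ℍ) : ℂ) = w := by
        rw [UpperHalfPlane.ofComplex_apply_of_im_pos hw]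
      simp [hF, this]
  refine ⟨F, hFan, ?_, ?_⟩
  · rw [lintegral_weightedArea α _ (h.growth.measurable_comp_norm hFan.continuous)]
    set k : ℝ := (Real.pi / (α + 1))⁻¹ * (1 / y ^ (2 + α)) with hk
    have hk0 : 0 < k := by positivity
    calc _ ≤ ∫⁻ w in {w : ℂ | 0 < w.im}, ENNReal.ofReal k * (ENNReal.ofReal (w.im ^ α) *
          ENNReal.ofReal ((y / ‖w - b‖) ^ (α + 4))) := by
          refine setLIntegral_mono' (measurableSet_lt measurable_const Complex.measurable_im) ?_
          intro w hw
          have hT := him w hw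
          have hT0 : 0 < ‖w - b‖ := hy.trans_le hT
          rw [mul_left_comm, ← ENNReal.ofReal_mul hk0.le, hnorm,
            UpperHalfPlane.ofComplex_apply_of_im_pos hw]
          refine mul_le_mul_right (ENNReal.ofReal_le_ofReal ?_) _
          change Φ (δ * (u * (y / ‖w - b‖) ^ N)) ≤ _
          set τ := y / ‖w - b‖ with hτ
          have hτ0 : 0 < τ := by positivity
          have hτ1 : τ ≤ 1 := (div_le_one hT0).2 hT
          calc Φ (δ * (u * τ ^ N)) ≤ (C * (Real.pi / (α + 1)))⁻¹ * Φ (u * τ ^ N) :=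
                hshrink _ (by positivity)
            _ ≤ (C * (Real.pi / (α + 1)))⁻¹ * (C * (τ ^ N) ^ p * Φ u) := by
                gcongr
                exact h.lower _ (by positivity) (pow_le_one₀ hτ0.le hτ1) _ hupos
            _ = k * (τ ^ N) ^ p := by rw [hΦu, hk]; field_simp
            _ ≤ k * τ ^ (α + 4) := by
                gcongr
                rw [← Real.rpow_natCast, ← Real.rpow_mul hτ0.le]
                exact Real.rpow_le_rpow_of_exponent_ge hτ0 hτ1 hN
      _ ≤ ENNReal.ofReal k * ENNReal.ofReal (Real.pi / (α + 1) * y ^ (2 + α)) := by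
          rw [lintegral_const_mul' _ _ ENNReal.ofReal_ne_top]
          exact mul_le_mul_right (setLIntegral_rpow_div_norm_le hα hy _) _
      _ = 1 := by
          rw [← ENNReal.ofReal_mul hk0.le, hk]
          have : y ^ (2 + α) ≠ 0 := by positivity
          rw [← ENNReal.ofReal_one]
          congr 1
          field_simp
  · rw [hnorm]
    have : (z : ℂ) - b = ((2 * y : ℝ) : ℂ) * Complex.I := by
      apply Complex.ext <;> simp [hb, hydef]
      ring
    rw [this, norm_mul, Complex.norm_I, mul_one, Complex.norm_real, Real.norm_eq_abs,
      abs_of_pos (by positivity)]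
    have : y / (2 * y) = 1 / 2 := by field_simp
    rw [this]; ring

theorem luxNorm_le {Φ : ℝ → ℝ} {α : ℝ} {F : ℍ → ℂ} {l : ℝ} (hl : 0 < l)
    (h : ∫⁻ z, ENNReal.ofReal (Φ (‖F z‖ / l)) ∂weightedArea α ≤ 1) :
    luxNorm Φ α F ≤ ENNReal.ofReal l :=
  iInf₂_le l ⟨hl, h⟩

theorem exists_lt_of_luxNorm_lt {Φ : ℝ → ℝ} {α : ℝ} {F : ℍ → ℂ} {b : ℝ}
    (h : luxNorm Φ α F < ENNReal.ofReal b) :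
    ∃ l : ℝ, 0 < l ∧ l < b ∧ ∫⁻ z, ENNReal.ofReal (Φ (‖F z‖ / l)) ∂weightedArea α ≤ 1 := by
  obtain ⟨l, hl⟩ := iInf_lt_iff.1 h
  obtain ⟨⟨hl0, hmod⟩, hlb⟩ := iInf_lt_iff.1 hl
  exact ⟨l, hl0, (ENNReal.ofReal_lt_ofReal_iff'.1 hlb).1, hmod⟩

theorem Analytic.mul {F G : ℍ → ℂ} (hF : Analytic F) (hG : Analytic G) : Analytic (F * G) :=
  UpperHalfPlane.mdifferentiable_iff.2 (hF.differentiableOn.mul hG.differentiableOn)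

theorem Analytic.const_mul {F : ℍ → ℂ} (hF : Analytic F) (c : ℂ) :
    Analytic (fun z => c * F z) :=
  UpperHalfPlane.mdifferentiable_iff.2 (hF.differentiableOn.const_mul c)

theorem norm_inv_ofReal_mul {l : ℝ} (hl : 0 < l) (w : ℂ) : ‖((l : ℂ)⁻¹) * w‖ = ‖w‖ / l := by
  rw [norm_mul, norm_inv, Complex.norm_real, Real.norm_of_nonneg hl.le, inv_mul_eq_div]

/-- A multiplier is dominated by the weight `ω`. -/
theorem exists_norm_le_of_mem_multipliers {Φ₁ Φ₂ : ℝ → ℝ} {α β p₁ q₁ C₁ p₂ q₂ C₂ : ℝ}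
    (h₁ : PowerBounded Φ₁ p₁ q₁ C₁) (h₂ : PowerBounded Φ₂ p₂ q₂ C₂) (hα : -1 < α)
    {G : ℍ → ℂ} (hG : G ∈ multipliers Φ₁ α Φ₂ β) :
    ∃ M : ℝ, 0 < M ∧ ∀ z : ℍ, ‖G z‖ ≤ M * multWeight Φ₁ α Φ₂ β z.im := by
  obtain ⟨hGan, C, hC, hmul⟩ := hG
  obtain ⟨c, hc, htest⟩ := h₁.exists_testFunction hα
  obtain ⟨K, hK, heval⟩ := h₂.exists_norm_le_growthInv β
  refine ⟨2 * C * K / c, by positivity, fun z => ?_⟩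
  obtain ⟨F, hF, hmod, hFz⟩ := htest z
  have hlux : luxNorm Φ₁ α F ≤ ENNReal.ofReal 1 := luxNorm_le one_pos (by simpa using hmod)
  have h3 := (hmul F ⟨hF, hlux.trans_lt ENNReal.ofReal_lt_top⟩).2
  have h4 : luxNorm Φ₂ β (F * G) < ENNReal.ofReal (2 * C) := by
    refine (h3.trans (mul_le_mul_right hlux _)).trans_lt ?_
    rw [← ENNReal.ofReal_mul hC.le, ENNReal.ofReal_lt_ofReal_iff (by positivity)]
    linarith
  obtain ⟨l, hl, hlC, hmod2⟩ := exists_lt_of_luxNorm_lt h4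
  have h5 := heval _ ((hF.mul hGan).const_mul ((l : ℂ)⁻¹))
    (by simpa only [norm_inv_ofReal_mul hl] using hmod2) z
  rw [norm_inv_ofReal_mul hl, Pi.mul_apply, norm_mul, hFz, div_le_iff₀ hl] at h5
  have hy := z.im_pos
  set u := growthInv Φ₁ (1 / z.im ^ (2 + α)) with hu
  set v := growthInv Φ₂ (1 / z.im ^ (2 + β)) with hv
  have hu0 : 0 < u := h₁.growth.growthInv_pos (by positivity)
  have hv0 : 0 < v := h₂.growth.growthInv_pos (by positivity)
  rw [multWeight, ← hu, ← hv, div_mul_div_comm, le_div_iff₀ (by positivity)]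
  have h6 : K * v * l ≤ K * v * (2 * C) := by gcongr
  linarith

/-- A pointwise criterion for being a multiplier. -/
theorem mem_multipliers_of_forall_le {Φ₁ Φ₂ : ℝ → ℝ} {α β L : ℝ} (h₁ : IsGrowth Φ₁)
    (h₂ : IsGrowth Φ₂) {G : ℍ → ℂ} (hG : Analytic G) (hL : 0 < L)
    (h : ∀ F : ℍ → ℂ, Analytic F →
      ∫⁻ z, ENNReal.ofReal (Φ₁ ‖F z‖) ∂weightedArea α ≤ 1 →
      ∀ z : ℍ, z.im ^ β * Φ₂ (‖F z‖ * ‖G z‖ / L) ≤ z.im ^ α * Φ₁ ‖F z‖) :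
    G ∈ multipliers Φ₁ α Φ₂ β := by
  have key : ∀ F : ℍ → ℂ, Analytic F →
      luxNorm Φ₂ β (F * G) ≤ ENNReal.ofReal L * luxNorm Φ₁ α F := by
    intro F hF
    have hL' : ENNReal.ofReal L ≠ 0 := (ENNReal.ofReal_pos.2 hL).ne'
    rw [luxNorm, luxNorm, ENNReal.mul_iInf_of_ne hL' ENNReal.ofReal_ne_top]
    refine le_iInf fun l => ?_
    rw [ENNReal.mul_iInf_of_ne hL' ENNReal.ofReal_ne_top]
    refine le_iInf fun hl => ?_
    rw [← ENNReal.ofReal_mul hL.le]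
    refine luxNorm_le (mul_pos hL hl.1) ?_
    have hF' := hF.const_mul ((l : ℂ)⁻¹)
    have hH : Analytic (fun z => ((L * l : ℝ) : ℂ)⁻¹ * (F * G) z) := (hF.mul hG).const_mul _
    have hmod : ∫⁻ z, ENNReal.ofReal (Φ₁ ‖(l : ℂ)⁻¹ * F z‖) ∂weightedArea α ≤ 1 := by
      simpa only [norm_inv_ofReal_mul hl.1] using hl.2
    have hpt := h _ hF' hmod
    refine le_trans ?_ hmod
    simp only [← norm_inv_ofReal_mul (mul_pos hL hl.1)]
    rw [lintegral_weightedArea _ _ (h₁.measurable_comp_norm hF'.continuous),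
      lintegral_weightedArea _ _ (h₂.measurable_comp_norm hH.continuous)]
    refine setLIntegral_mono' (measurableSet_lt measurable_const Complex.measurable_im) ?_
    intro w hw
    have hw0 : 0 < w.im := hw
    have h3 := hpt (UpperHalfPlane.ofComplex w)
    have him : (UpperHalfPlane.ofComplex w).im = w.im := by
      rw [UpperHalfPlane.ofComplex_apply_of_im_pos hw]; rfl
    rw [← ENNReal.ofReal_mul (by positivity), ← ENNReal.ofReal_mul (by positivity)]
    refine ENNReal.ofReal_le_ofReal (le_of_eq_of_le ?_ (him ▸ h3))
    rw [norm_inv_ofReal_mul (mul_pos hL hl.1), norm_inv_ofReal_mul hl.1, Pi.mul_apply, norm_mul]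
    congr 2
    field_simp
  exact ⟨hG, L, hL, fun F hF => ⟨⟨hF.1.mul hG,
    (key F hF.1).trans_lt (ENNReal.mul_lt_top ENNReal.ofReal_lt_top hF.2)⟩, key F hF.1⟩⟩

theorem zero_mem_multipliers {Φ₁ Φ₂ : ℝ → ℝ} (h₁ : IsGrowth Φ₁) (h₂ : IsGrowth Φ₂) (α β : ℝ) :
    (0 : ℍ → ℂ) ∈ multipliers Φ₁ α Φ₂ β := by
  have h0 : Analytic (0 : ℍ → ℂ) :=
    UpperHalfPlane.mdifferentiable_iff.2 (differentiableOn_const (0 : ℂ))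
  refine mem_multipliers_of_forall_le h₁ h₂ h0 one_pos fun F _ _ z => ?_
  have := z.im_pos
  have := h₁.nonneg (norm_nonneg (F z))
  simp only [Pi.zero_apply, norm_zero, mul_zero, zero_div, h₂.map_zero]
  positivity

/-- Analytic functions bounded by `ω` are multipliers if some power separates `Φ₁` and `Φ₂`. -/
theorem mem_multipliers_of_le_multWeight {Φ₁ Φ₂ : ℝ → ℝ} {α β a p q C M : ℝ}
    (h₁ : PowerBounded Φ₁ p q C) (h₂ : IsGrowth Φ₂)
    (hΦ₁ : ∀ s τ : ℝ, 0 < s → 0 < τ → τ ≤ 1 → τ ^ a * Φ₁ s ≤ Φ₁ (τ * s))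
    (hΦ₂ : ∀ s τ : ℝ, 0 < s → 0 < τ → τ ≤ 1 → Φ₂ (τ * s) ≤ τ ^ a * Φ₂ s)
    {G : ℍ → ℂ} (hG : Analytic G) (hM : 0 < M)
    (hle : ∀ z : ℍ, ‖G z‖ ≤ M * multWeight Φ₁ α Φ₂ β z.im) :
    G ∈ multipliers Φ₁ α Φ₂ β := by
  obtain ⟨K₀, hK₀, heval⟩ := h₁.exists_norm_le_growthInv α
  set K := max K₀ 1 with hKdef
  have hK1 : 1 ≤ K := le_max_right _ _
  have hK : 0 < K := one_pos.trans_le hK1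
  refine mem_multipliers_of_forall_le h₁.growth h₂ hG (mul_pos hK hM) fun F hF hmod z => ?_
  have hy := z.im_pos
  have hFz := heval F hF hmod z
  have hGz := hle z
  rw [multWeight] at hGz
  set y := z.im
  have hy₁ : 0 < 1 / y ^ (2 + α) := by positivity
  have hy₂ : 0 < 1 / y ^ (2 + β) := by positivity
  have hΦu := h₁.growth.map_growthInv hy₁.le
  have hΦv := h₂.map_growthInv hy₂.le
  have hu := h₁.growth.growthInv_pos hy₁
  have hv := h₂.growthInv_pos hy₂
  set u := growthInv Φ₁ (1 / y ^ (2 + α))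
  set v := growthInv Φ₂ (1 / y ^ (2 + β))
  have hΦF := h₁.growth.nonneg (norm_nonneg (F z))
  rcases (norm_nonneg (F z)).eq_or_lt with h0 | h0
  · simp only [← h0, zero_mul, zero_div, h₂.map_zero, h₁.growth.map_zero, mul_zero, le_refl]
  set τ := ‖F z‖ / (K * u) with hτ
  have hτ0 : 0 < τ := by positivity
  have hτ1 : τ ≤ 1 := by
    rw [hτ, div_le_one (by positivity)]
    exact hFz.trans (by gcongr; exact le_max_left _ _)
  have h3 : ‖F z‖ * ‖G z‖ / (K * M) ≤ τ * v := by
    calc ‖F z‖ * ‖G z‖ / (K * M) ≤ ‖F z‖ * (M * (v / u)) / (K * M) := by gcongr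
      _ = τ * v := by rw [hτ]; field_simp
  have h4 : τ * u ≤ ‖F z‖ := by
    calc τ * u = ‖F z‖ / K := by rw [hτ]; field_simp
      _ ≤ ‖F z‖ := div_le_self h0.le hK1
  have h5 : y ^ β * (1 / y ^ (2 + β)) = y ^ α * (1 / y ^ (2 + α)) := by
    rw [Real.rpow_add hy, Real.rpow_add hy]
    have := (Real.rpow_pos_of_pos hy α).ne'
    have := (Real.rpow_pos_of_pos hy β).ne'
    field_simp
  calc y ^ β * Φ₂ (‖F z‖ * ‖G z‖ / (K * M)) ≤ y ^ β * Φ₂ (τ * v) := by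
        gcongr; exact h₂.le_of_le (by positivity) h3
    _ ≤ y ^ β * (τ ^ a * Φ₂ v) := by gcongr; exact hΦ₂ v τ hv hτ0 hτ1
    _ = y ^ α * (τ ^ a * Φ₁ u) := by rw [hΦu, hΦv, mul_left_comm, h5]; ring
    _ ≤ y ^ α * Φ₁ (τ * u) := by gcongr; exact hΦ₁ u τ hu hτ0 hτ1
    _ ≤ y ^ α * Φ₁ ‖F z‖ := by gcongr; exact h₁.growth.le_of_le (by positivity) h4

/-- Bounded analytic functions are multipliers if `ω` is bounded below. -/
theorem mem_multipliers_of_norm_le {Φ₁ Φ₂ : ℝ → ℝ} {α β p q C c M : ℝ}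
    (h₁ : PowerBounded Φ₁ p q C) (h₂ : IsGrowth Φ₂)
    (hmono : MonotoneOn (fun t => Φ₂ t / Φ₁ t) (Ioi 0)) (hc : 1 ≤ c)
    (hω : ∀ t : ℝ, 0 < t → c⁻¹ ≤ multWeight Φ₁ α Φ₂ β t)
    {G : ℍ → ℂ} (hG : Analytic G) (hM : 0 < M) (hle : ∀ z : ℍ, ‖G z‖ ≤ M) :
    G ∈ multipliers Φ₁ α Φ₂ β := by
  have hc0 : 0 < c := one_pos.trans_le hc
  obtain ⟨K₀, hK₀, heval⟩ := h₁.exists_norm_le_growthInv α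
  set K := max K₀ 1 with hKdef
  have hK1 : 1 ≤ K := le_max_right _ _
  have hK : 0 < K := one_pos.trans_le hK1
  obtain ⟨D, hD, hdil⟩ := h₁.exists_dilate_le hc0
  obtain ⟨δ, hδ, hδ1, hshrink⟩ := h₁.exists_shrink_le (ε := D⁻¹) (by positivity)
  refine mem_multipliers_of_forall_le (L := M * (K * c) / δ) h₁.growth h₂ hG (by positivity)
    fun F hF hmod z => ?_
  have hy := z.im_pos
  have hFz := heval F hF hmod z
  have hGz := hle z
  have hωz := hω z.im hy
  rw [multWeight] at hωz
  set y := z.im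
  have hy₁ : 0 < 1 / y ^ (2 + α) := by positivity
  have hy₂ : 0 < 1 / y ^ (2 + β) := by positivity
  have hΦu := h₁.growth.map_growthInv hy₁.le
  have hΦv := h₂.map_growthInv hy₂.le
  have hu := h₁.growth.growthInv_pos hy₁
  have hv := h₂.growthInv_pos hy₂
  set u := growthInv Φ₁ (1 / y ^ (2 + α))
  set v := growthInv Φ₂ (1 / y ^ (2 + β))
  rcases (norm_nonneg (F z)).eq_or_lt with h0 | h0
  · simp only [← h0, zero_mul, zero_div, h₂.map_zero, h₁.growth.map_zero, mul_zero, le_refl]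
  set s := ‖F z‖ / (K * c) with hs
  have hs0 : 0 < s := by positivity
  have hδs : 0 < δ * s := by positivity
  have h3 : ‖F z‖ * ‖G z‖ / (M * (K * c) / δ) ≤ δ * s := by
    calc ‖F z‖ * ‖G z‖ / (M * (K * c) / δ) ≤ ‖F z‖ * M / (M * (K * c) / δ) := by gcongr
      _ = δ * s := by rw [hs]; field_simp
  have h4 : s ≤ u / c := by
    rw [hs, div_le_div_iff₀ (by positivity) hc0]
    have : ‖F z‖ ≤ K * u := hFz.trans (by gcongr; exact le_max_left _ _)
    calc ‖F z‖ * c ≤ K * u * c := by gcongr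
      _ = u * (K * c) := by ring
  have h5 : u / c ≤ v := by
    rw [le_div_iff₀ hu, inv_mul_le_iff₀ hc0] at hωz
    rwa [div_le_iff₀' hc0]
  have huc : 0 < u / c := by positivity
  have hΦuc := h₁.pos_of_pos huc
  have hΦδs := h₁.pos_of_pos hδs
  have h6 : Φ₂ (δ * s) / Φ₁ (δ * s) ≤ Φ₂ v / Φ₁ (u / c) := by
    refine (hmono hδs huc ((mul_le_of_le_one_left hs0.le hδ1).trans h4)).trans ?_
    simp only
    gcongr
    exact h₂.le_of_le huc.le h5
  have h7 : Φ₁ u ≤ D * Φ₁ (u / c) := by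
    simpa [mul_div_cancel₀, hc0.ne'] using hdil (u / c) huc.le
  have h8 : D * Φ₁ (δ * s) ≤ Φ₁ ‖F z‖ := by
    have := hshrink s hs0.le
    rw [le_inv_mul_iff₀ hD] at this
    refine this.trans (h₁.growth.le_of_le hs0.le (div_le_self h0.le ?_))
    exact one_le_mul_of_one_le_of_one_le hK1 hc
  have h9 : Φ₂ (δ * s) * Φ₁ u ≤ Φ₂ v * Φ₁ ‖F z‖ := by
    rw [div_le_div_iff₀ hΦδs hΦuc] at h6
    have hnn := h₂.nonneg hδs.le
    have hnn' := h₂.nonneg hv.le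
    calc Φ₂ (δ * s) * Φ₁ u ≤ Φ₂ (δ * s) * (D * Φ₁ (u / c)) := by gcongr
      _ = D * (Φ₂ (δ * s) * Φ₁ (u / c)) := by ring
      _ ≤ D * (Φ₂ v * Φ₁ (δ * s)) := by gcongr
      _ = Φ₂ v * (D * Φ₁ (δ * s)) := by ring
      _ ≤ _ := by gcongr
  rw [hΦu, hΦv, mul_one_div, one_div_mul_eq_div, div_le_div_iff₀ (by positivity) (by positivity),
    Real.rpow_add hy, Real.rpow_add hy] at h9
  have h10 : y ^ β * Φ₂ (δ * s) ≤ y ^ α * Φ₁ ‖F z‖ := by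
    refine le_of_mul_le_mul_left (a := y ^ (2 : ℝ)) ?_ (by positivity)
    linarith
  refine le_trans ?_ h10
  gcongr
  exact h₂.le_of_le (by positivity) h3

theorem eq_zero_of_norm_le_multWeight {Φ₁ Φ₂ : ℝ → ℝ} {α β M : ℝ} (h₁ : IsGrowth Φ₁)
    (h₂ : IsGrowth Φ₂) (hα : -1 < α) (hβ : -1 < β)
    (hlim : Tendsto (multWeight Φ₁ α Φ₂ β) (𝓝[>] 0) (𝓝 0))
    {G : ℍ → ℂ} (hG : Analytic G) (hM : 0 < M)
    (hle : ∀ z : ℍ, ‖G z‖ ≤ M * multWeight Φ₁ α Φ₂ β z.im) : G = 0 := by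
  funext z
  have ht := z.im_pos
  set t := z.im with htdef
  set ω := multWeight Φ₁ α Φ₂ β with hω
  set g : ℂ → ℂ := fun w => (G ∘ UpperHalfPlane.ofComplex) (w * Complex.I) with hg
  have hgle : ∀ w : ℂ, 0 < w.re → ‖g w‖ ≤ M * ω w.re := by
    intro w hw
    have him : 0 < (w * Complex.I).im := by simpa using hw
    have := hle (UpperHalfPlane.ofComplex (w * Complex.I))
    rw [UpperHalfPlane.ofComplex_apply_of_im_pos him] at this
    have h3 : (⟨w * Complex.I, him⟩ : ℍ).im = w.re := by
      change (w * Complex.I).im = w.re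
      simp
    rw [h3] at this
    simpa only [hg, Function.comp_apply, UpperHalfPlane.ofComplex_apply_of_im_pos him] using this
  have hgd : DifferentiableOn ℂ g {w | 0 < w.re} := by
    refine hG.differentiableOn.comp (by fun_prop) fun w hw => ?_
    simpa using hw
  have hgz : g (-Complex.I * z) = G z := by
    have : -Complex.I * z * Complex.I = z := by
      linear_combination (-(z : ℂ)) * Complex.I_mul_I
    simp only [hg, this, Function.comp_apply, UpperHalfPlane.ofComplex_apply]
  have hzre : (-Complex.I * z).re = t := by simp [htdef]
  have hmono : ∀ ε s : ℝ, 0 < ε → ε ≤ s → s ≤ 2 * t → ω s ≤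
      growthInv Φ₂ (1 / ε ^ (2 + β)) / growthInv Φ₁ (1 / (2 * t) ^ (2 + α)) := by
    intro ε s hε hεs hst
    have hs : 0 < s := hε.trans_le hεs
    have h3 := h₁.growthInv_pos (y := 1 / (2 * t) ^ (2 + α)) (by positivity)
    have h4 := h₂.growthInv_mem (y := 1 / ε ^ (2 + β)) (by positivity)
    have hα2 : 0 ≤ 2 + α := by linarith
    have hβ2 : 0 ≤ 2 + β := by linarith
    rw [hω, multWeight]
    gcongr
    · exact h₂.growthInv_mono (by positivity) (by gcongr)
    · exact h₁.growthInv_mono (by positivity) (by gcongr)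
  have hB : 0 < M * ω (2 * t) := mul_pos hM (h₁.multWeight_pos h₂ (by positivity))
  have hbound : ∀ ε ∈ Ioo 0 t, ‖G z‖ ≤
      (M * ω ε) ^ (1 - (t - ε) / (2 * t - ε)) * (M * ω (2 * t)) ^ ((t - ε) / (2 * t - ε)) := by
    intro ε hε
    have hsub : Complex.HadamardThreeLines.verticalClosedStrip ε (2 * t) ⊆ {w : ℂ | 0 < w.re} :=
      fun w hw => hε.1.trans_le hw.1
    have h3 := Complex.HadamardThreeLines.norm_le_interp_of_mem_verticalClosedStrip' (f := g)
      (z := -Complex.I * z) (a := M * ω ε) (b := M * ω (2 * t)) (l := ε) (u := 2 * t)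
      (by linarith [hε.2]) ?_ ?_ ?_ ?_ ?_
    · rwa [hgz, hzre] at h3
    · change (-Complex.I * z).re ∈ Icc ε (2 * t)
      rw [hzre]
      exact ⟨hε.2.le, by linarith⟩
    · refine (hgd.mono ?_).diffContOnCl
      refine (closure_minimal ?_ (isClosed_Icc.preimage Complex.continuous_re)).trans hsub
      exact fun w hw => Ioo_subset_Icc_self hw
    · refine ⟨M * (growthInv Φ₂ (1 / ε ^ (2 + β)) / growthInv Φ₁ (1 / (2 * t) ^ (2 + α))), ?_⟩
      rintro _ ⟨w, hw, rfl⟩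
      refine (hgle w (hsub hw)).trans ?_
      gcongr
      exact hmono ε w.re hε.1 hw.1 hw.2
    · rintro w hw
      have hw' : w.re = ε := hw
      simpa only [hw'] using hgle w (hw' ▸ hε.1)
    · rintro w hw
      have hw' : w.re = 2 * t := hw
      simpa only [hw'] using hgle w (hw' ▸ by positivity)
  have hexp : Tendsto (fun ε => (t - ε) / (2 * t - ε)) (𝓝[>] 0) (𝓝 (1 / 2)) := by
    have : ContinuousAt (fun ε => (t - ε) / (2 * t - ε)) 0 :=
      ContinuousAt.div (by fun_prop) (by fun_prop) (by simpa using ht.ne')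
    have h3 := this.tendsto.mono_left (nhdsWithin_le_nhds (s := Ioi 0))
    convert h3 using 2
    simp only [sub_zero]
    field_simp
  have hlim' : Tendsto (fun ε => (M * ω ε) ^ (1 - (t - ε) / (2 * t - ε)) *
      (M * ω (2 * t)) ^ ((t - ε) / (2 * t - ε))) (𝓝[>] 0)
      (𝓝 ((M * 0) ^ (1 - 1 / 2 : ℝ) * (M * ω (2 * t)) ^ (1 / 2 : ℝ))) :=
    ((hlim.const_mul M).rpow (hexp.const_sub 1) (Or.inr (by norm_num))).mul
      (tendsto_const_nhds.rpow hexp (Or.inl hB.ne'))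
  have h0 : ‖G z‖ ≤ (M * 0) ^ (1 - 1 / 2 : ℝ) * (M * ω (2 * t)) ^ (1 / 2 : ℝ) :=
    ge_of_tendsto hlim' (mem_of_superset (Ioo_mem_nhdsGT ht) hbound)
  rw [mul_zero, Real.zero_rpow (by norm_num), zero_mul] at h0
  exact norm_le_zero_iff.1 h0

end BergmanOrlicz

theorem theorem2p6 (Φ₁ Φ₂ : ℝ → ℝ) (α β : ℝ)
    (hΦ₁ : BergmanOrlicz.MemLU Φ₁) (hΦ₂ : BergmanOrlicz.MemLUTilde Φ₂)
    (hmono : MonotoneOn (fun t => Φ₂ t / Φ₁ t) (Ioi 0))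
    (hα : -1 < α) (hβ : -1 < β) :
    -- (i)
    (0 < BergmanOrlicz.lowerIndex Φ₁ →
      BergmanOrlicz.lowerIndex Φ₁ ≤ BergmanOrlicz.upperIndex Φ₁ →
      BergmanOrlicz.upperIndex Φ₁ < BergmanOrlicz.lowerIndex Φ₂ →
      BergmanOrlicz.lowerIndex Φ₂ ≤ BergmanOrlicz.upperIndex Φ₂ →
      BergmanOrlicz.upperIndex Φ₂ < ⊤ →
      BergmanOrlicz.multipliers Φ₁ α Φ₂ β =
        BergmanOrlicz.weightedHInfty (BergmanOrlicz.multWeight Φ₁ α Φ₂ β)) ∧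
    -- (ii)
    ((∃ c : ℝ, 0 < c ∧ ∀ t : ℝ, 0 < t →
        c⁻¹ ≤ BergmanOrlicz.multWeight Φ₁ α Φ₂ β t ∧
        BergmanOrlicz.multWeight Φ₁ α Φ₂ β t ≤ c) →
      BergmanOrlicz.multipliers Φ₁ α Φ₂ β = BergmanOrlicz.hInfty) ∧
    -- (iii)
    (Tendsto (BergmanOrlicz.multWeight Φ₁ α Φ₂ β) (𝓝[>] 0) (𝓝 0) →
      BergmanOrlicz.multipliers Φ₁ α Φ₂ β = {0}) := by
  obtain ⟨p₁, q₁, C₁, h₁⟩ := hΦ₁.exists_powerBounded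
  obtain ⟨p₂, q₂, C₂, h₂⟩ := hΦ₂.memLU.exists_powerBounded
  refine ⟨fun _ _ hlt _ _ => ?_, fun ⟨c, hc, hω⟩ => ?_, fun hlim => ?_⟩
  · obtain ⟨a, ha₁, ha₂⟩ := EReal.lt_iff_exists_real_btwn.1 hlt
    ext G
    constructor
    · intro hG
      obtain ⟨M, hM, hle⟩ := BergmanOrlicz.exists_norm_le_of_mem_multipliers h₁ h₂ hα hG
      refine ⟨hG.1, M, ?_⟩
      rintro _ ⟨z, rfl⟩
      exact (div_le_iff₀ (h₁.growth.multWeight_pos h₂.growth z.im_pos)).2 (hle z)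
    · rintro ⟨hG, M, hM⟩
      refine BergmanOrlicz.mem_multipliers_of_le_multWeight (a := a) (M := max M 1) h₁ h₂.growth
        (fun s τ hs hτ hτ1 => BergmanOrlicz.le_map_mul_of_upperIndex_le hΦ₁.differentiableOn
          (fun x hx => h₁.pos_of_pos hx) ha₁.le hs hτ hτ1)
        (fun s τ hs hτ hτ1 => BergmanOrlicz.map_mul_le_of_le_lowerIndex
          hΦ₂.memLU.differentiableOn (fun x hx => h₂.pos_of_pos hx) ha₂.le hs hτ hτ1)
        hG (by positivity) fun z => ?_
      have hω := h₁.growth.multWeight_pos (α := α) (β := β) h₂.growth z.im_pos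
      exact (div_le_iff₀ hω).1 ((hM ⟨z, rfl⟩).trans (le_max_left _ _))
  · have hc1 : 1 ≤ c := by
      have := (hω 1 one_pos).1.trans (hω 1 one_pos).2
      rw [inv_le_iff_one_le_mul₀ hc] at this
      nlinarith
    ext G
    constructor
    · intro hG
      obtain ⟨M, hM, hle⟩ := BergmanOrlicz.exists_norm_le_of_mem_multipliers h₁ h₂ hα hG
      refine ⟨hG.1, M * c, ?_⟩
      rintro _ ⟨z, rfl⟩
      exact (hle z).trans (mul_le_mul_of_nonneg_left (hω _ z.im_pos).2 hM.le)
    · rintro ⟨hG, M, hM⟩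
      exact BergmanOrlicz.mem_multipliers_of_norm_le (M := max M 1) h₁ h₂.growth hmono hc1
        (fun t ht => (hω t ht).1) hG (by positivity)
        fun z => (hM ⟨z, rfl⟩).trans (le_max_left _ _)
  · ext G
    constructor
    · intro hG
      obtain ⟨M, hM, hle⟩ := BergmanOrlicz.exists_norm_le_of_mem_multipliers h₁ h₂ hα hG
      exact BergmanOrlicz.eq_zero_of_norm_le_multWeight h₁.growth h₂.growth hα hβ hlim hG.1 hM hle
    · rintro rfl
      exact BergmanOrlicz.zero_mem_multipliers h₁.growth h₂.growth α β
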